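/- For a finite graph $G$, let $\gamma_e(G)$ be the smallest size of a set $\Gamma$ of edges of $G$ such that every edge of $G$ shares at least one vertex with an edge in $\Gamma$. For a prime power $q$ and an integer $n\ge 2$, let $D$ be the design of points and hyperplanes of the projective space $\mathrm{PG}(n,q)$, let $\gamma_e(D)$ be $\gamma_e$ of its incidence graph (the bipartite graph on the points and hyperplanes, a point being adjacent to a hyperplane when it lies on it), and let $\theta_n=\frac{q^{n+1}-1}{q-1}$ be the number of points of $\mathrm{PG}(n,q)$. Then $\gamma_e(D)=\theta_n-\Theta\bigl(q^{(n+1)/2}\bigr)$; that is, there are absolute constants $c,C>0$ such that for all integers $n\ge 2$ and all prime powers $q$, $$c\,q^{(n+1)/2}\;\le\;\theta_n-\gamma_e(D)\;\le\;C\,q^{(n+1)/2}.$$ -/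

import Mathlib

open scoped LinearAlgebra.Projectivization

/-- A set `Γ` of edges of `G` such that every edge of `G` shares a vertex with an edge in `Γ`. -/
def IsEdgeDominating {V : Type*} (G : SimpleGraph V) (Γ : Set (Sym2 V)) : Prop :=
  Γ ⊆ G.edgeSet ∧ ∀ e ∈ G.edgeSet, ∃ e' ∈ Γ, ∃ v : V, v ∈ e ∧ v ∈ e'

/-- The edge domination number: the smallest size of an edge dominating set
(for a finite graph such sets exist, because the set of all edges is one). -/
noncomputable def edgeDominationNumber {V : Type*} (G : SimpleGraph V) : ℕ :=
  sInf {m : ℕ | ∃ Γ : Finset (Sym2 V), IsEdgeDominating G (Γ : Set (Sym2 V)) ∧ Γ.card = m}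

/-- In a finite graph the edge domination number is attained. -/
theorem exists_edgeDominating_card_eq {V : Type*} [Finite V] (G : SimpleGraph V) :
    ∃ Γ : Finset (Sym2 V), IsEdgeDominating G (Γ : Set (Sym2 V)) ∧
      Γ.card = edgeDominationNumber G := by
  refine Nat.sInf_mem
    (s := {m : ℕ | ∃ Γ : Finset (Sym2 V), IsEdgeDominating G (Γ : Set (Sym2 V)) ∧ Γ.card = m}) ?_
  refine ⟨_, (Set.toFinite G.edgeSet).toFinset, ?_, rfl⟩
  rw [Set.Finite.coe_toFinset]
  refine ⟨subset_rfl, fun e he => ⟨e, he, ?_⟩⟩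
  induction e with
  | _ x y => exact ⟨x, by simp, by simp⟩

/-- An incidence structure: a type of points with a collection of subsets, called blocks. -/
structure IncidenceStructure (P : Type*) where
  blocks : Set (Set P)

/-- The incidence graph (Levi graph): bipartite on points and blocks, a point being adjacent to
a block exactly when it lies in it. -/
def IncidenceStructure.incidenceGraph {P : Type*} (D : IncidenceStructure P) :
    SimpleGraph (P ⊕ D.blocks) where
  Adj
    | .inl p, .inr B => p ∈ (B : Set P)
    | .inr B, .inl p => p ∈ (B : Set P)
    | _, _ => False
  symm := ⟨by rintro (p | B) (p' | B') h <;> exact h⟩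
  loopless := ⟨by rintro (p | B) h <;> exact h⟩

/-- `γ_e(D)`: the edge domination number of the incidence graph of `D`. -/
noncomputable def IncidenceStructure.edgeDominationNumber {P : Type*}
    (D : IncidenceStructure P) : ℕ :=
  _root_.edgeDominationNumber D.incidenceGraph

/-- The points and hyperplanes of the projective space `PG(n, F)` of `F ^ (n + 1)`. A hyperplane is
the set of points contained in a linear subspace of vector space dimension `n`, that is, of
projective dimension `n - 1`. -/
def pointHyperplaneDesign (n : ℕ) (F : Type*) [Field F] :
    IncidenceStructure (ℙ F (Fin (n + 1) → F)) where
  blocks := {B | ∃ W : Submodule F (Fin (n + 1) → F), Module.finrank F W = n ∧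
    B = {p | p.submodule ≤ W}}

/-- `θ_n = (q ^ (n + 1) - 1) / (q - 1)`, for `q ≥ 2` the number of points of `PG(n, q)`. -/
noncomputable def projTheta (n q : ℕ) : ℝ :=
  ((q : ℝ) ^ (n + 1) - 1) / ((q : ℝ) - 1)

/-! The deficit `θ_n - γ_e` is governed by incidence-free pairs. The points and blocks left
uncovered by a dominating set form such a pair, and each edge covers one point and one block, so
both sides have size at least `θ_n - γ_e`. In a symmetric design, Cauchy–Schwarz
(`IncidenceFree.card_mul_card_le`) makes the product of the two sizes at most `4 q ^ (n + 1)` here,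
which gives the upper bound.

For the lower bound, take an incidence-free pair with both sides of size `m` and cover everything
else by few edges. Hall's theorem with deficiency does this: a violation would be a second
incidence-free pair, too large for the same Cauchy–Schwarz bound (`IncidenceFree.exists_cover`).
About `m / 2` edges are saved.

A pair with `m` of order `q ^ ((n + 1) / 2)` comes from affine points `(x, y)` and hyperplanes `y =
x ⬝ᵥ m + b` (`exists_incidenceFree_orthogonal`): the trace to the prime field keeps the residues of
`x ⬝ᵥ m + b` and of `y` in disjoint intervals. -/

/-! ### Incidence-free pairs in symmetric designs -/

/-- A set of points `S` and a set of blocks `T` without incidences between them. -/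
def IncidenceFree {P H : Type*} (I : P → H → Prop) (S : Finset P) (T : Finset H) : Prop :=
  ∀ p ∈ S, ∀ h ∈ T, ¬ I p h

/-- The bound on incidence-free pairs of sets in a symmetric design with parameters
`(v, l + m, l)`, by the Cauchy-Schwarz inequality. -/
theorem IncidenceFree.card_mul_card_le {P H : Type*} [Fintype P] [Fintype H] {I : P → H → Prop}
    {v l m : ℕ} (hH : Fintype.card H = v)
    (hk : ∀ p, Nat.card {h // I p h} = l + m)
    (hl : ∀ p p', p ≠ p' → Nat.card {h // I p h ∧ I p' h} = l)
    (hv : (l + m) ^ 2 = m + l * v) (hv0 : 0 < v)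
    {S : Finset P} {T : Finset H} (hST : IncidenceFree I S T) :
    ((l : ℝ) + m) ^ 2 * (S.card * T.card) ≤ m * ((v - S.card) * (v - T.card)) := by
  classical
  let a : P → H → ℝ := fun p h => if I p h then 1 else 0
  have ha1 (p : P) : ∑ h, a p h = l + m := by
    rw [← Nat.cast_add, ← hk p, Nat.card_eq_fintype_card, Fintype.card_subtype]
    simp [a]
  have ha2 (p p' : P) : ∑ h, a p h * a p' h = l + if p = p' then (m : ℝ) else 0 := by
    split_ifs with hp
    · subst hp
      rw [← ha1 p]
      refine Finset.sum_congr rfl fun h _ => ?_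
      simp [a]
    · rw [add_zero, ← hl p p' hp, Nat.card_eq_fintype_card, Fintype.card_subtype]
      simp [a, ← ite_and, and_comm]
  let N : H → ℝ := fun h => ∑ p ∈ S, a p h
  have hN0 (h : H) (hh : h ∈ T) : N h = 0 :=
    Finset.sum_eq_zero fun p hp => if_neg (hST p hp h hh)
  have hN1 : ∑ h ∈ Tᶜ, N h = S.card * (l + m) := by
    have h0 : ∑ h ∈ T, N h = 0 := Finset.sum_eq_zero hN0
    have h1 := Finset.sum_add_sum_compl T N
    rw [h0, zero_add] at h1
    rw [h1, Finset.sum_comm]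
    simp [ha1, mul_add]
  have hN2 : ∑ h, N h ^ 2 = S.card * (S.card * l + m) := by
    calc ∑ h, N h ^ 2 = ∑ h, ∑ p ∈ S, ∑ p' ∈ S, a p h * a p' h := by
          refine Finset.sum_congr rfl fun h _ => ?_
          rw [sq, Finset.sum_mul_sum]
      _ = ∑ p ∈ S, ∑ p' ∈ S, ∑ h, a p h * a p' h := by
          rw [Finset.sum_comm]
          exact Finset.sum_congr rfl fun p _ => Finset.sum_comm
      _ = ∑ p ∈ S, ((S.card : ℝ) * l + m) := by
          refine Finset.sum_congr rfl fun p hp => ?_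
          simp only [ha2, Finset.sum_add_distrib, Finset.sum_ite_eq, if_pos hp]
          simp
      _ = _ := by simp [mul_add]
  -- `N` vanishes on `T`, so Cauchy–Schwarz is applied with only `v - T.card` terms.
  have hcs : (∑ h ∈ Tᶜ, N h) ^ 2 ≤ (Tᶜ.card : ℝ) * ∑ h ∈ Tᶜ, N h ^ 2 :=
    sq_sum_le_card_mul_sum_sq
  have hle : ∑ h ∈ Tᶜ, N h ^ 2 ≤ ∑ h, N h ^ 2 :=
    Finset.sum_le_sum_of_subset_of_nonneg (Finset.subset_univ _) fun _ _ _ => sq_nonneg _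
  have hT : (Tᶜ.card : ℝ) = v - T.card := by
    rw [Finset.card_compl, Nat.cast_sub (Finset.card_le_univ _), hH]
  have hvt : (0 : ℝ) ≤ v - T.card := hT ▸ Nat.cast_nonneg _
  rw [hN1, hT] at hcs
  have hv' : ((l : ℝ) + m) ^ 2 = m + l * v := by exact_mod_cast hv
  have h2 : ((S.card : ℝ) * (l + m)) ^ 2 ≤ (v - T.card) * (S.card * (S.card * l + m)) :=
    hcs.trans (mul_le_mul_of_nonneg_left (hle.trans hN2.le) hvt)
  have hv1 : (0 : ℝ) < v := by exact_mod_cast hv0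
  rcases Nat.eq_zero_or_pos S.card with hs | hs
  · rw [hs]
    have := mul_nonneg (Nat.cast_nonneg (α := ℝ) m) (mul_nonneg hv1.le hvt)
    simpa using this
  have hs' : (0 : ℝ) < S.card := by exact_mod_cast hs
  have h3 : (S.card : ℝ) * ((l : ℝ) + m) ^ 2 ≤ (v - T.card) * (S.card * l + m) := by
    refine le_of_mul_le_mul_left ?_ hs'
    linarith [h2]
  -- After multiplying by `v`, the identity `v * l = (l + m) ^ 2 - m` makes the inequality symmetric
  -- in `S` and `T`.
  have h4 := mul_le_mul_of_nonneg_left h3 hv1.le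
  have h5 : (v : ℝ) * l = (l + m) ^ 2 - m := by rw [hv']; ring
  have h6 : (v : ℝ) * ((v - T.card) * (S.card * l + m)) =
      (v - T.card) * (S.card * ((l + m) ^ 2 - m) + v * m) := by rw [← h5]; ring
  rw [h6] at h4
  nlinarith [h4]

/-! ### Covering by a matching with deficiency -/

/-- Hall's theorem with deficiency: if the neighbourhood of every set falls short of its size by at
most `d`, there is an injection into the disjoint union with `d` extra elements. -/
theorem exists_injective_of_card_le_biUnion_add {ι α : Type*} [DecidableEq α]
    (t : ι → Finset α) (d : ℕ) (ht : ∀ s : Finset ι, s.card ≤ (s.biUnion t).card + d) :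
    ∃ f : ι → α ⊕ Fin d, Function.Injective f ∧ ∀ i a, f i = Sum.inl a → a ∈ t i := by
  classical
  obtain ⟨f, hf, hft⟩ := (Finset.all_card_le_biUnion_card_iff_exists_injective
    (fun i => (t i).disjSum (Finset.univ : Finset (Fin d)))).1 (by
      intro s
      rcases s.eq_empty_or_nonempty with rfl | ⟨i, hi⟩
      · simp
      have : (s.biUnion t).disjSum (Finset.univ : Finset (Fin d)) ⊆
          s.biUnion fun i => (t i).disjSum (Finset.univ : Finset (Fin d)) := by
        rintro (a | a) ha
        · simpa using ha
        · simpa using ⟨i, hi⟩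
      refine le_trans ?_ (Finset.card_le_card this)
      simpa using ht s)
  exact ⟨f, hf, fun i a h => by simpa [h] using hft i⟩

/-- If incidence-free pairs outside `X` and `Y` are small, there are few incidences covering
all points outside `X` and all blocks outside `Y`. -/
theorem exists_cover_of_incidenceFree_small {P H : Type*} [Fintype P] [Fintype H]
    {I : P → H → Prop} (hI : ∀ p, ∃ h, I p h) (hI' : ∀ h, ∃ p, I p h)
    {X : Finset P} {Y : Finset H} {m d v : ℕ} (hX : X.card = m) (hY : Y.card = m)
    (hP : Fintype.card P = v) (hH : Fintype.card H = v)
    (hST : ∀ S T, IncidenceFree I S T → Disjoint S X → Disjoint T Y →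
      S.card + T.card ≤ v - m + d) :
    ∃ Γ : Finset (P × H), (∀ e ∈ Γ, I e.1 e.2) ∧ (∀ p ∉ X, ∃ e ∈ Γ, e.1 = p) ∧
      (∀ h ∉ Y, ∃ e ∈ Γ, e.2 = h) ∧ Γ.card ≤ v - m + d := by
  classical
  let t : {p // p ∉ X} → Finset H := fun p => {h | h ∉ Y ∧ I p h}
  obtain ⟨f, hf, hft⟩ := exists_injective_of_card_le_biUnion_add t d (by
    intro s
    -- The points of `s` and the blocks outside `Y` that miss all of them form an incidence-free
    -- pair; its size bound is the deficient Hall condition.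
    have h1 := hST (s.map (Function.Embedding.subtype _)) (Yᶜ \ s.biUnion t) (by
        intro p hp h hh hph
        simp only [Finset.mem_map, Function.Embedding.subtype_apply] at hp
        obtain ⟨p, hp, rfl⟩ := hp
        rw [Finset.mem_sdiff, Finset.mem_compl] at hh
        exact hh.2 (Finset.mem_biUnion.2 ⟨p, hp, by simp [t, hh.1, hph]⟩))
      (by
        rw [Finset.disjoint_left]
        intro p hp
        simp only [Finset.mem_map, Function.Embedding.subtype_apply] at hp
        obtain ⟨p, hp, rfl⟩ := hp
        exact p.2)
      (Finset.disjoint_of_subset_left Finset.sdiff_subset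
        (Finset.disjoint_left.2 fun h hh => Finset.mem_compl.1 hh))
    have h2 : s.biUnion t ⊆ Yᶜ := by
      intro h hh
      obtain ⟨p, -, hp⟩ := Finset.mem_biUnion.1 hh
      exact Finset.mem_compl.2 (by simpa [t] using hp : h ∉ Y ∧ I p h).1
    rw [Finset.card_map, Finset.card_sdiff_of_subset h2, Finset.card_compl, hH, hY] at h1
    have h3 := Finset.card_le_card h2
    rw [Finset.card_compl, hH, hY] at h3
    omega)
  choose g hg using hI
  choose g' hg' using hI'
  -- Points matched to a dummy element receive an arbitrary block through them.
  let b : {p // p ∉ X} → H := fun p => Sum.elim id (fun _ => g p) (f p)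
  have hb (p : {p // p ∉ X}) : I p (b p) := by
    rcases hp : f p with h | i
    · simpa [b, hp] using (by simpa [t] using hft p h hp : h ∉ Y ∧ I p h).2
    · simpa [b, hp] using hg p
  let Γ₁ : Finset (P × H) := Finset.univ.image fun p : {p // p ∉ X} => ((p : P), b p)
  let R : Finset H := Yᶜ \ Finset.univ.image b
  let Γ₂ : Finset (P × H) := R.image fun h => (g' h, h)
  have hcard₁ : Γ₁.card ≤ v - m := by
    refine Finset.card_image_le.trans ?_
    rw [Finset.card_univ, Fintype.card_subtype_compl, hP]
    simp [hX]
  have hcard₂ : Γ₂.card ≤ d := by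
    refine Finset.card_image_le.trans ?_
    let Z : Finset (H ⊕ Fin d) := Finset.univ.image f
    have hZ : Z.card = v - m := by
      rw [Finset.card_image_of_injective _ hf, Finset.card_univ, Fintype.card_subtype_compl, hP]
      simp [hX]
    have hZl : Z.toLeft ⊆ Yᶜ := by
      intro h hh
      obtain ⟨p, -, hp⟩ := Finset.mem_image.1 (Finset.mem_toLeft.1 hh)
      exact Finset.mem_compl.2 (by simpa [t] using hft p h hp : h ∉ Y ∧ I p h).1
    -- At most `d` points use dummies, so the matching hits all but at most `d` blocks of `Yᶜ`; each
    -- remaining block costs one extra incidence.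
    have hR : R ⊆ Yᶜ \ Z.toLeft := by
      refine Finset.sdiff_subset_sdiff subset_rfl fun h hh => ?_
      obtain ⟨p, -, hp⟩ := Finset.mem_image.1 (Finset.mem_toLeft.1 hh)
      exact Finset.mem_image.2 ⟨p, Finset.mem_univ _, by simp [b, hp]⟩
    have h1 := Finset.card_le_card hR
    rw [Finset.card_sdiff_of_subset hZl, Finset.card_compl, hH, hY] at h1
    have h2 := Z.card_toLeft_add_card_toRight
    have h3 : Z.toRight.card ≤ d := by simpa using Finset.card_le_univ Z.toRight
    omega
  refine ⟨Γ₁ ∪ Γ₂, ?_, ?_, ?_, ?_⟩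
  · intro e he
    rcases Finset.mem_union.1 he with he | he
    · obtain ⟨p, -, rfl⟩ := Finset.mem_image.1 he
      exact hb p
    · obtain ⟨h, -, rfl⟩ := Finset.mem_image.1 he
      exact hg' h
  · intro p hp
    exact ⟨(p, b ⟨p, hp⟩), Finset.mem_union_left _
      (Finset.mem_image.2 ⟨⟨p, hp⟩, Finset.mem_univ _, rfl⟩), rfl⟩
  · intro h hh
    by_cases hR : h ∈ R
    · exact ⟨(g' h, h), Finset.mem_union_right _ (Finset.mem_image.2 ⟨h, hR, rfl⟩), rfl⟩
    · have : h ∈ Finset.univ.image b := by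
        by_contra hc
        exact hR (Finset.mem_sdiff.2 ⟨Finset.mem_compl.2 hh, hc⟩)
      obtain ⟨p, -, rfl⟩ := Finset.mem_image.1 this
      exact ⟨(p, b p), Finset.mem_union_left _
        (Finset.mem_image.2 ⟨p, Finset.mem_univ _, rfl⟩), rfl⟩
  · exact (Finset.card_union_le _ _).trans (add_le_add hcard₁ hcard₂)

/-- In a symmetric design with parameters `(v, l + μ, l)` in which `4 μ < (l + μ) ^ 2`, an
incidence-free pair of sets of size `m` gives a set of fewer than `v - m / 2` incidences covering
everything outside the pair. -/
theorem IncidenceFree.exists_cover {P H : Type*} [Fintype P] [Fintype H] {I : P → H → Prop}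
    {v l μ m : ℕ} (hP : Fintype.card P = v) (hH : Fintype.card H = v)
    (hk : ∀ p, Nat.card {h // I p h} = l + μ)
    (hl : ∀ p p', p ≠ p' → Nat.card {h // I p h ∧ I p' h} = l)
    (hv : (l + μ) ^ 2 = μ + l * v) (hμ : 4 * μ < (l + μ) ^ 2) (hI' : ∀ h, ∃ p, I p h)
    {X : Finset P} {Y : Finset H} (hX : X.card = m) (hY : Y.card = m) (hm : 0 < m) :
    ∃ Γ : Finset (P × H), (∀ e ∈ Γ, I e.1 e.2) ∧ (∀ p ∉ X, ∃ e ∈ Γ, e.1 = p) ∧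
      (∀ h ∉ Y, ∃ e ∈ Γ, e.2 = h) ∧ 2 * Γ.card + m ≤ 2 * v := by
  have hmv : m ≤ v := hX ▸ hP ▸ Finset.card_le_univ X
  have hI (p : P) : ∃ h, I p h := by
    by_contra hc
    have : IsEmpty {h // I p h} := ⟨fun h => hc ⟨h, h.2⟩⟩
    have h0 := hk p
    rw [Nat.card_of_isEmpty] at h0
    rw [← h0] at hμ
    omega
  obtain ⟨Γ, h1, h2, h3, h4⟩ := exists_cover_of_incidenceFree_small (d := (m - 1) / 2) hI hI' hX hY
    hP hH (by
      classical
      intro S T hST hSX hTY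
      by_contra! hc
      have h1 := hST.card_mul_card_le hH hk hl hv (by omega)
      have hS : S.card + m ≤ v := by
        rw [← hX, ← Finset.card_union_of_disjoint hSX, ← hP]
        exact Finset.card_le_univ _
      have hT : T.card + m ≤ v := by
        rw [← hY, ← Finset.card_union_of_disjoint hTY, ← hH]
        exact Finset.card_le_univ _
      have hs0 : 0 < S.card := by omega
      have ht0 : 0 < T.card := by omega
      -- Each set has more than `(m - 1) / 2` elements, since the other has at most `v - m`. Hence
      -- `(v - S.card) * (v - T.card)` is at most `4 * S.card * T.card`, against `4 * μ < (l + μ) ^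
      -- 2`.
      have hs : v ≤ S.card + 2 * T.card := by omega
      have ht : v ≤ T.card + 2 * S.card := by omega
      have hs' : (v : ℝ) - S.card ≤ 2 * T.card := by
        have : (v : ℝ) ≤ S.card + 2 * T.card := by exact_mod_cast hs
        linarith
      have ht' : (v : ℝ) - T.card ≤ 2 * S.card := by
        have : (v : ℝ) ≤ T.card + 2 * S.card := by exact_mod_cast ht
        linarith
      have ht'' : (0 : ℝ) ≤ v - T.card := by
        rw [sub_nonneg]
        exact_mod_cast (by omega : T.card ≤ v)
      have h2 : ((v : ℝ) - S.card) * (v - T.card) ≤ 2 * T.card * (2 * S.card) :=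
        mul_le_mul hs' ht' ht'' (by positivity)
      have h3 : ((l : ℝ) + μ) ^ 2 * (S.card * T.card) ≤ 4 * μ * (S.card * T.card) := by
        refine h1.trans ((mul_le_mul_of_nonneg_left h2 (Nat.cast_nonneg _)).trans_eq ?_)
        ring
      have h4 : ((l : ℝ) + μ) ^ 2 ≤ 4 * μ := le_of_mul_le_mul_right h3 (by positivity)
      have h5 : (l + μ) ^ 2 ≤ 4 * μ := by exact_mod_cast h4
      omega)
  exact ⟨Γ, h1, h2, h3, by omega⟩

/-! ### Edge domination in incidence graphs -/

namespace IncidenceStructure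

variable {P : Type*} (D : IncidenceStructure P)

theorem mem_edgeSet_incidenceGraph {e : Sym2 (P ⊕ D.blocks)} :
    e ∈ D.incidenceGraph.edgeSet ↔
      ∃ (p : P) (B : D.blocks), p ∈ (B : Set P) ∧ e = s(.inl p, .inr B) := by
  constructor
  · induction e with
    | _ x y =>
      intro h
      rcases x with p | B <;> rcases y with p' | B'
      · exact h.elim
      · exact ⟨p, B', h, rfl⟩
      · exact ⟨p', B, h, Sym2.eq_swap⟩
      · exact h.elim
  · rintro ⟨p, B, h, rfl⟩
    exact h

/-- The points and the blocks that are left uncovered by a smallest edge dominating set. -/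
theorem exists_incidenceFree_of_edgeDominationNumber [Fintype P] [Fintype D.blocks] :
    ∃ (X : Finset P) (Y : Finset D.blocks),
      IncidenceFree (fun p (B : D.blocks) => p ∈ (B : Set P)) X Y ∧
      Fintype.card P ≤ X.card + D.edgeDominationNumber ∧
      Fintype.card D.blocks ≤ Y.card + D.edgeDominationNumber := by
  classical
  obtain ⟨Γ, ⟨hΓ, hdom⟩, hcard⟩ := exists_edgeDominating_card_eq D.incidenceGraph
  -- Used for `Z` all covered points, then all covered blocks: an edge contains only one of each, so
  -- choosing a covering edge is injective.
  have hcov (Z : Finset (P ⊕ D.blocks)) (hZ : ∀ z ∈ Z, ∃ e ∈ Γ, z ∈ e)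
      (hinj : ∀ z ∈ Z, ∀ z' ∈ Z, ∀ e ∈ Γ, z ∈ e → z' ∈ e → z = z') : Z.card ≤ Γ.card := by
    choose f hf hf' using hZ
    rw [← Finset.card_attach]
    refine Finset.card_le_card_of_injOn (fun z => f z z.2) (fun z _ => hf z z.2)
      fun z _ z' _ h => Subtype.ext ?_
    have h' : f z z.2 = f z' z'.2 := h
    exact hinj z z.2 z' z'.2 (f z z.2) (hf z z.2) (hf' z z.2) (h' ▸ hf' z' z'.2)
  let X : Finset P := {p | ∀ e ∈ Γ, Sum.inl p ∉ e}
  let Y : Finset D.blocks := {B | ∀ e ∈ Γ, Sum.inr B ∉ e}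
  refine ⟨X, Y, ?_, ?_, ?_⟩
  · intro p hp B hB hpB
    obtain ⟨e, he, v, hv, hve⟩ := hdom s(.inl p, .inr B)
      (D.mem_edgeSet_incidenceGraph.2 ⟨p, B, hpB, rfl⟩)
    rcases Sym2.mem_iff.1 hv with rfl | rfl
    · exact (Finset.mem_filter.1 hp).2 e he hve
    · exact (Finset.mem_filter.1 hB).2 e he hve
  · have h1 := hcov (Xᶜ.map Function.Embedding.inl) (by
      intro z hz
      obtain ⟨p, hp, rfl⟩ := Finset.mem_map.1 hz
      simpa [X] using hp) (by
      intro z hz z' hz' e he hze hze'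
      obtain ⟨p, hp, rfl⟩ := Finset.mem_map.1 hz
      obtain ⟨p', hp', rfl⟩ := Finset.mem_map.1 hz'
      obtain ⟨p₁, B, -, rfl⟩ := D.mem_edgeSet_incidenceGraph.1 (hΓ he)
      have h1 : p = p₁ := by simpa using hze
      have h2 : p' = p₁ := by simpa using hze'
      rw [h1, h2])
    rw [Finset.card_map, Finset.card_compl, hcard] at h1
    change _ ≤ X.card + _root_.edgeDominationNumber _
    omega
  · have h1 := hcov (Yᶜ.map Function.Embedding.inr) (by
      intro z hz
      obtain ⟨p, hp, rfl⟩ := Finset.mem_map.1 hz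
      simpa [Y] using hp) (by
      intro z hz z' hz' e he hze hze'
      obtain ⟨p, hp, rfl⟩ := Finset.mem_map.1 hz
      obtain ⟨p', hp', rfl⟩ := Finset.mem_map.1 hz'
      obtain ⟨p₁, B, -, rfl⟩ := D.mem_edgeSet_incidenceGraph.1 (hΓ he)
      have h1 : p = B := by simpa using hze
      have h2 : p' = B := by simpa using hze'
      rw [h1, h2])
    rw [Finset.card_map, Finset.card_compl, hcard] at h1
    change _ ≤ Y.card + _root_.edgeDominationNumber _
    omega

theorem edgeDominationNumber_le_card {X : Finset P} {Y : Finset D.blocks}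
    (hXY : IncidenceFree (fun p (B : D.blocks) => p ∈ (B : Set P)) X Y)
    {Γ : Finset (P × D.blocks)} (hΓ : ∀ e ∈ Γ, e.1 ∈ (e.2 : Set P))
    (hp : ∀ p ∉ X, ∃ e ∈ Γ, e.1 = p) (hB : ∀ B ∉ Y, ∃ e ∈ Γ, e.2 = B) :
    D.edgeDominationNumber ≤ Γ.card := by
  classical
  let Δ : Finset (Sym2 (P ⊕ D.blocks)) := Γ.image fun e => s(.inl e.1, .inr e.2)
  refine le_trans (Nat.sInf_le ⟨Δ, ⟨?_, ?_⟩, rfl⟩) Finset.card_image_le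
  · intro e he
    obtain ⟨e, heΓ, rfl⟩ := Finset.mem_image.1 (Finset.mem_coe.1 he)
    exact D.mem_edgeSet_incidenceGraph.2 ⟨e.1, e.2, hΓ e heΓ, rfl⟩
  · intro e he
    obtain ⟨p, B, hpB, rfl⟩ := D.mem_edgeSet_incidenceGraph.1 he
    by_cases hpX : p ∈ X
    · obtain ⟨e, heΓ, rfl⟩ := hB B fun h => hXY p hpX B h hpB
      exact ⟨_, Finset.mem_coe.2 (Finset.mem_image_of_mem _ heΓ), .inr e.2, by simp, by simp⟩
    · obtain ⟨e, heΓ, rfl⟩ := hp p hpX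
      exact ⟨_, Finset.mem_coe.2 (Finset.mem_image_of_mem _ heΓ), .inl e.1, by simp, by simp⟩

end IncidenceStructure

/-! ### Points and hyperplanes as a symmetric design -/

namespace Projectivization

variable {F V : Type*} [Field F] [AddCommGroup V] [Module F V]

theorem card_submodule_le [Finite F] {W : Submodule F V} {r : ℕ} (hW : Module.finrank F W = r) :
    Nat.card {h : ℙ F V // h.submodule ≤ W} = ∑ i ∈ Finset.range r, Nat.card F ^ i := by
  rw [← card_of_finrank F W hW]
  symm
  refine Nat.card_congr (Equiv.ofBijective
    (fun p : ℙ F W => ⟨map W.subtype W.injective_subtype p, ?_⟩) ⟨fun p p' h => ?_, ?_⟩)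
  · induction p with | h w hw =>
    rw [map_mk, submodule_mk, Submodule.span_singleton_le_iff_mem]
    exact w.2
  · exact map_injective _ W.injective_subtype (congrArg Subtype.val h)
  · rintro ⟨p, hp⟩
    induction p with | h w hw =>
    rw [submodule_mk, Submodule.span_singleton_le_iff_mem] at hp
    exact ⟨mk F ⟨w, hp⟩ fun h => hw (congrArg Subtype.val h), rfl⟩

variable {n : ℕ}

theorem finrank_ker_mulVecLin {m r : ℕ} {M : Matrix (Fin r) (Fin m) F}
    (hM : LinearIndependent F M.row) : Module.finrank F (LinearMap.ker M.mulVecLin) + r = m := by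
  have h1 := M.mulVecLin.finrank_range_add_finrank_ker
  have h2 : Module.finrank F (LinearMap.range M.mulVecLin) = r := by
    exact hM.rank_matrix.trans (Fintype.card_fin r)
  rw [h2, Module.finrank_fin_fun] at h1
  omega

theorem card_orthogonal [Finite F] (p : ℙ F (Fin (n + 1) → F)) :
    Nat.card {h // orthogonal p h} = ∑ i ∈ Finset.range n, Nat.card F ^ i := by
  induction p with | h v hv =>
  have hM : LinearIndependent F (Matrix.of ![v]).row :=
    LinearIndependent.of_subsingleton (R := F) (v := ![v]) 0 (by simpa)
  rw [← card_submodule_le (W := LinearMap.ker (Matrix.of ![v]).mulVecLin)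
    (by have := finrank_ker_mulVecLin hM; omega)]
  refine Nat.card_congr (Equiv.subtypeEquivRight fun h => ?_)
  induction h with | h w hw =>
  rw [submodule_mk, Submodule.span_singleton_le_iff_mem, orthogonal_mk hv hw]
  simp [funext_iff]

theorem card_orthogonal_and_orthogonal [Finite F] {p p' : ℙ F (Fin (n + 1) → F)} (hp : p ≠ p') :
    Nat.card {h // orthogonal p h ∧ orthogonal p' h} =
      ∑ i ∈ Finset.range (n - 1), Nat.card F ^ i := by
  induction p with | h v hv =>
  induction p' with | h v' hv' =>
  have hM : LinearIndependent F (Matrix.of ![v, v']).row := by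
    rw [Ne, mk_eq_mk_iff', not_exists, ← LinearIndependent.pair_iff' hv'] at hp
    exact LinearIndependent.pair_symm_iff.1 hp
  rw [← card_submodule_le (W := LinearMap.ker (Matrix.of ![v, v']).mulVecLin)
    (by have := finrank_ker_mulVecLin hM; omega)]
  refine Nat.card_congr (Equiv.subtypeEquivRight fun h => ?_)
  induction h with | h w hw =>
  rw [submodule_mk, Submodule.span_singleton_le_iff_mem, orthogonal_mk hv hw,
    orthogonal_mk hv' hw]
  simp [funext_iff, Fin.forall_fin_two]

end Projectivization

section Hyperplanes

open Projectivization

variable {n : ℕ} {F : Type*} [Field F]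

theorem setOf_orthogonal_mem_blocks (h : ℙ F (Fin (n + 1) → F)) :
    {p | orthogonal p h} ∈ (pointHyperplaneDesign n F).blocks := by
  induction h with | h w hw =>
  have hM : LinearIndependent F (Matrix.of ![w]).row :=
    LinearIndependent.of_subsingleton (R := F) (v := ![w]) 0 (by simpa)
  refine ⟨LinearMap.ker (Matrix.of ![w]).mulVecLin,
    by have := finrank_ker_mulVecLin hM; omega, ?_⟩
  ext p
  induction p with | h v hv =>
  rw [Set.mem_ofPred_eq, Set.mem_ofPred_eq, submodule_mk, Submodule.span_singleton_le_iff_mem,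
    orthogonal_comm, orthogonal_mk hw hv]
  simp [funext_iff]

/-- A proper subspace lies in the kernel of a nonzero functional, which is a dot product; equal
dimensions force equality. -/
theorem exists_setOf_orthogonal_eq {B : Set (ℙ F (Fin (n + 1) → F))}
    (hB : B ∈ (pointHyperplaneDesign n F).blocks) : ∃ h, {p | orthogonal p h} = B := by
  obtain ⟨W, hW, rfl⟩ := hB
  have hlt : W < ⊤ := by
    rw [lt_top_iff_ne_top]
    rintro rfl
    rw [finrank_top, Module.finrank_fin_fun] at hW
    omega
  obtain ⟨f, hf, hWf⟩ := Submodule.exists_le_ker_of_lt_top W hlt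
  obtain ⟨w, rfl⟩ := (dotProductEquiv F (Fin (n + 1))).surjective f
  have hw : w ≠ 0 := by
    rintro rfl
    simp at hf
  have hker : W = LinearMap.ker (dotProductEquiv F (Fin (n + 1)) w) := by
    refine Submodule.eq_of_le_of_finrank_eq hWf ?_
    have := Module.Dual.finrank_ker_add_one_of_ne_zero hf
    rw [Module.finrank_fin_fun] at this
    omega
  refine ⟨mk F w hw, ?_⟩
  ext p
  induction p with | h v hv =>
  rw [Set.mem_ofPred_eq, Set.mem_ofPred_eq, submodule_mk, Submodule.span_singleton_le_iff_mem,
    orthogonal_comm, orthogonal_mk hw hv, hker]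
  simp

theorem geom_sum_lt_succ {q : ℕ} (hq : 0 < q) (m : ℕ) :
    ∑ i ∈ Finset.range m, q ^ i < ∑ i ∈ Finset.range (m + 1), q ^ i := by
  rw [Finset.sum_range_succ]
  exact Nat.lt_add_of_pos_right (pow_pos hq m)

/-- Hyperplanes as points of the dual space, by orthogonality. -/
noncomputable def equivBlocks [Finite F] (hn : 1 ≤ n) :
    ℙ F (Fin (n + 1) → F) ≃ (pointHyperplaneDesign n F).blocks :=
  Equiv.ofBijective (fun h => ⟨{p | orthogonal p h}, setOf_orthogonal_mem_blocks h⟩) (by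
    refine ⟨fun h h' hh => ?_, fun B => ?_⟩
    -- Distinct points with the same orthogonal set would have too many common orthogonal points.
    · by_contra hne
      have h1 : ∀ p, orthogonal p h ↔ orthogonal p h' :=
        fun p => Set.ext_iff.1 (congrArg Subtype.val hh) p
      have h2 := card_orthogonal_and_orthogonal hne
      have h3 := card_orthogonal h
      simp only [orthogonal_comm (v := h), orthogonal_comm (v := h'), ← h1, and_self] at h2 h3
      rw [h2] at h3
      have := geom_sum_lt_succ (q := Nat.card F) Nat.card_pos (n - 1)
      rw [Nat.sub_add_cancel hn] at this
      omega
    · obtain ⟨h, hh⟩ := exists_setOf_orthogonal_eq B.2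
      exact ⟨h, Subtype.ext hh⟩)

theorem card_blocks_mem [Finite F] (hn : 1 ≤ n) (p : ℙ F (Fin (n + 1) → F)) :
    Nat.card {B : (pointHyperplaneDesign n F).blocks // p ∈ (B : Set _)} =
      ∑ i ∈ Finset.range n, Nat.card F ^ i := by
  rw [← card_orthogonal p]
  exact (Nat.card_congr ((equivBlocks hn).subtypeEquiv fun h => Iff.rfl)).symm

theorem card_blocks_mem_and_mem [Finite F] (hn : 1 ≤ n) {p p' : ℙ F (Fin (n + 1) → F)}
    (hp : p ≠ p') :
    Nat.card {B : (pointHyperplaneDesign n F).blocks // p ∈ (B : Set _) ∧ p' ∈ (B : Set _)} =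
      ∑ i ∈ Finset.range (n - 1), Nat.card F ^ i := by
  rw [← card_orthogonal_and_orthogonal hp]
  exact (Nat.card_congr ((equivBlocks hn).subtypeEquiv fun h => Iff.rfl)).symm

end Hyperplanes

/-! ### Construction of large incidence-free pairs -/

theorem ZMod.card_filter_val_mem_Ico {p : ℕ} [NeZero p] (a b : ℕ) (hb : b ≤ p) :
    (Finset.univ.filter fun x : ZMod p => x.val ∈ Finset.Ico a b).card = b - a := by
  rw [← Nat.card_Ico]
  refine Finset.card_bij' (fun x _ => x.val) (fun k _ => (k : ZMod p)) ?_ ?_ ?_ ?_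
  · intro x hx
    exact (Finset.mem_filter.1 hx).2
  · intro k hk
    rw [Finset.mem_filter, ZMod.val_cast_of_lt ((Finset.mem_Ico.1 hk).2.trans_le hb)]
    exact ⟨Finset.mem_univ _, hk⟩
  · intro x _
    exact ZMod.natCast_zmod_val x
  · intro k hk
    exact ZMod.val_cast_of_lt ((Finset.mem_Ico.1 hk).2.trans_le hb)

/-- The fibres of a surjective homomorphism all have the same size. -/
theorem AddMonoidHom.card_filter_mem_mul_card {G H : Type*} [AddGroup G] [AddGroup H] [Fintype G]
    [Fintype H] [DecidableEq H] (τ : G →+ H) (hτ : Function.Surjective τ) (S : Finset H) :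
    (Finset.univ.filter fun y => τ y ∈ S).card * Fintype.card H = S.card * Fintype.card G := by
  have hc (x : H) : (Finset.univ.filter fun y => τ y = x).card =
      (Finset.univ.filter fun y => τ y = 0).card := by
    have := AddMonoidHom.card_fiber_eq_of_mem_range τ (hτ x) (hτ 0)
    simpa using this
  have hS (S : Finset H) : (Finset.univ.filter fun y => τ y ∈ S).card =
      S.card * (Finset.univ.filter fun y => τ y = 0).card := by
    rw [Finset.card_eq_sum_card_fiberwise (f := τ) (t := S) (fun y hy => by simpa using hy),
      Finset.sum_const_nat]
    intro x hx
    rw [← hc x, Finset.filter_filter]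
    congr 1
    ext y
    simp only [Finset.mem_filter, Finset.mem_univ, true_and]
    exact ⟨fun h => h.2, fun h => ⟨h ▸ hx, h⟩⟩
  have h1 := hS Finset.univ
  simp only [Finset.mem_univ, Finset.filter_true, Finset.card_univ] at h1
  rw [hS S, h1]
  ring

/-- Two sets of about `p ^ (N / 2)` vectors in `N`-dimensional space over `ZMod p` whose
products have small residues. -/
theorem exists_card_sq_ge_val_sum_le {p : ℕ} [Fact p.Prime] (l r : ℕ) (hr : r ≤ 1) :
    ∃ A M : Finset ((Fin l ⊕ Fin l) ⊕ Fin r → ZMod p),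
      p ^ (l + l + r) ≤ 4 * A.card ^ 2 ∧ p ^ (l + l + r) ≤ 4 * M.card ^ 2 ∧
      ∀ a ∈ A, ∀ m ∈ M, (∑ i, a i * m i).val ≤ p / 4 := by
  have hp := (Fact.out : p.Prime).two_le
  let J : Finset (ZMod p) :=
    Finset.univ.filter fun x => x.val ∈ Finset.Ico 0 (Nat.sqrt (p / 4) + 1)
  have hJ : J.card = Nat.sqrt (p / 4) + 1 :=
    ZMod.card_filter_val_mem_Ico _ _ (by have := Nat.sqrt_le_self (p / 4); omega)
  have hJp : p ^ r ≤ 4 * (J.card ^ r) ^ 2 := by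
    interval_cases r
    · simp
    · have := Nat.lt_succ_sqrt (p / 4)
      rw [hJ, pow_one, pow_one, sq]
      simp only [Nat.succ_eq_add_one] at this
      omega
  -- Complementary coordinate blocks annihilate each other. If the dimension is odd, one coordinate
  -- is left, where both factors are at most `√(p / 4)`.
  refine ⟨Fintype.piFinset (Sum.elim (Sum.elim (fun _ => Finset.univ) fun _ => {0}) fun _ => J),
    Fintype.piFinset (Sum.elim (Sum.elim (fun _ => {0}) fun _ => Finset.univ) fun _ => J),
    ?_, ?_, ?_⟩
  · simp only [Fintype.card_piFinset, Fintype.prod_sum_type, Sum.elim_inl, Sum.elim_inr,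
      Finset.prod_const, Finset.card_univ, Fintype.card_fin, ZMod.card, Finset.card_singleton,
      one_pow, mul_one]
    calc p ^ (l + l + r) = (p ^ l) ^ 2 * p ^ r := by ring
      _ ≤ (p ^ l) ^ 2 * (4 * (J.card ^ r) ^ 2) := Nat.mul_le_mul_left _ hJp
      _ = _ := by ring
  · simp only [Fintype.card_piFinset, Fintype.prod_sum_type, Sum.elim_inl, Sum.elim_inr,
      Finset.prod_const, Finset.card_univ, Fintype.card_fin, ZMod.card, Finset.card_singleton,
      one_pow, one_mul]
    calc p ^ (l + l + r) = (p ^ l) ^ 2 * p ^ r := by ring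
      _ ≤ (p ^ l) ^ 2 * (4 * (J.card ^ r) ^ 2) := Nat.mul_le_mul_left _ hJp
      _ = _ := by ring
  · intro a ha m hm
    rw [Fintype.mem_piFinset] at ha hm
    have h1 (i : Fin l) : a (.inl (.inl i)) * m (.inl (.inl i)) = 0 := by
      have := hm (.inl (.inl i))
      simp only [Sum.elim_inl, Finset.mem_singleton] at this
      rw [this, mul_zero]
    have h2 (i : Fin l) : a (.inl (.inr i)) * m (.inl (.inr i)) = 0 := by
      have := ha (.inl (.inr i))
      simp only [Sum.elim_inl, Sum.elim_inr, Finset.mem_singleton] at this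
      rw [this, zero_mul]
    have h3 (i : Fin r) : (a (.inr i) * m (.inr i)).val ≤ p / 4 := by
      have h4 := ha (.inr i)
      have h5 := hm (.inr i)
      simp only [Sum.elim_inr, J, Finset.mem_filter, Finset.mem_Ico, Nat.lt_succ_iff] at h4 h5
      rw [ZMod.val_mul]
      exact (Nat.mod_le _ _).trans ((Nat.mul_le_mul h4.2.2 h5.2.2).trans (Nat.sqrt_le _))
    simp only [Fintype.sum_sum_type, h1, h2, Finset.sum_const_zero, zero_add]
    interval_cases r
    · simp
    · simpa using h3 0

/-- Two sets of about `q ^ (k / 2)` vectors over a finite field whose dot products are mapped to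
small residues. -/
theorem exists_card_sq_ge_val_dotProduct_le {p : ℕ} [Fact p.Prime] {F : Type*} [Field F]
    [Fintype F] [Algebra (ZMod p) F] {τ : F →ₗ[ZMod p] ZMod p} (hτ : τ ≠ 0) (k : ℕ) :
    ∃ A M : Finset (Fin k → F), Fintype.card F ^ k ≤ 4 * A.card ^ 2 ∧
      Fintype.card F ^ k ≤ 4 * M.card ^ 2 ∧
      ∀ x ∈ A, ∀ m ∈ M, (τ (x ⬝ᵥ m)).val ≤ p / 4 := by
  classical
  obtain ⟨y₀, hy₀⟩ : ∃ y, τ y ≠ 0 := by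
    by_contra! h
    exact hτ (LinearMap.ext h)
  let B : (Fin k → F) →ₗ[ZMod p] (Fin k → F) →ₗ[ZMod p] ZMod p :=
    LinearMap.mk₂ (ZMod p) (fun x m => τ (x ⬝ᵥ m)) (by simp [add_dotProduct])
      (by simp [smul_dotProduct]) (by simp [dotProduct_add]) (by simp [dotProduct_smul])
  have hB (x m : Fin k → F) : B x m = τ (x ⬝ᵥ m) := rfl
  have : Module.Finite (ZMod p) F := Module.Finite.of_finite
  let N := Module.finrank (ZMod p) (Fin k → F)
  obtain ⟨l, r, hr, hN⟩ : ∃ l r, r ≤ 1 ∧ N = l + l + r := ⟨N / 2, N % 2, by omega, by omega⟩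
  let e : Module.Basis ((Fin l ⊕ Fin l) ⊕ Fin r) (ZMod p) (Fin k → F) :=
    (Module.finBasis (ZMod p) (Fin k → F)).reindex
      ((finCongr hN).trans (((finSumFinEquiv).sumCongr (Equiv.refl _)).trans finSumFinEquiv).symm)
  have hcard : Fintype.card F ^ k = p ^ (l + l + r) := by
    rw [← hN, ← ZMod.card p, ← Module.card_eq_pow_finrank (K := ZMod p)]
    simp
  -- Coordinates dual to the basis `e` under the trace form `B`, which is nondegenerate; in them `B`
  -- becomes the standard dot product.
  let Φ : (Fin k → F) →ₗ[ZMod p] ((Fin l ⊕ Fin l) ⊕ Fin r → ZMod p) :=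
    LinearMap.pi fun i => B (e i)
  have hΦ : Function.Injective Φ := by
    rw [← LinearMap.ker_eq_bot, LinearMap.ker_eq_bot']
    intro m hm
    have h0 : B.flip m = 0 := e.ext fun i => congrFun hm i
    by_contra hne
    obtain ⟨j, hj⟩ := Function.ne_iff.1 hne
    refine hy₀ ?_
    have h1 := LinearMap.congr_fun h0 (Pi.single j (y₀ / m j))
    rw [LinearMap.flip_apply, hB, single_dotProduct, div_mul_cancel₀ _ hj] at h1
    exact h1
  have hbij : Function.Bijective Φ :=
    (Fintype.bijective_iff_injective_and_card Φ).2 ⟨hΦ, by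
      rw [Fintype.card_fun, Fintype.card_fun, Fintype.card_fin, hcard]
      simp [add_assoc]⟩
  let Ψ := Equiv.ofBijective Φ hbij
  obtain ⟨A, M, hA, hM, hAM⟩ := exists_card_sq_ge_val_sum_le (p := p) l r hr
  refine ⟨A.map e.equivFun.symm.toEquiv.toEmbedding, M.map Ψ.symm.toEmbedding, ?_, ?_, ?_⟩
  · rwa [Finset.card_map, hcard]
  · rwa [Finset.card_map, hcard]
  · intro x hx m hm
    obtain ⟨a, ha, rfl⟩ := Finset.mem_map.1 hx
    obtain ⟨b, hb, rfl⟩ := Finset.mem_map.1 hm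
    convert hAM a ha b hb using 2
    have h1 : Φ (Ψ.symm b) = b := Ψ.apply_symm_apply b
    have h2 (i) : B (e i) (Ψ.symm b) = b i := congrFun h1 i
    change B (e.equivFun.symm a) (Ψ.symm b) = _
    rw [Module.Basis.equivFun_symm_apply, map_sum, LinearMap.sum_apply]
    simp [h2]

open Projectivization in
/-- Large incidence-free sets of points and hyperplanes: points `(x, y)` and hyperplanes
`y = x ⬝ᵥ m + b` in affine space. -/
theorem exists_incidenceFree_orthogonal (F : Type*) [Field F] [Fintype F] (k : ℕ) :
    ∃ S T : Finset (ℙ F (Fin (k + 2) → F)), IncidenceFree orthogonal S T ∧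
      Fintype.card F ^ (k + 2) ≤ 256 * S.card ^ 2 ∧
      Fintype.card F ^ (k + 2) ≤ 256 * T.card ^ 2 := by
  classical
  let p := ringChar F
  have : Fact p.Prime := ⟨CharP.char_is_prime F p⟩
  let : Algebra (ZMod p) F := ZMod.algebra F p
  obtain ⟨y₀, hy₀⟩ := FiniteField.trace_to_zmod_nondegenerate F (one_ne_zero (α := F))
  rw [one_mul] at hy₀
  let τ : F →ₗ[ZMod p] ZMod p := Algebra.trace (ZMod p) F
  have hτ : τ ≠ 0 := fun h => hy₀ (LinearMap.congr_fun h y₀)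
  have hsurj : Function.Surjective τ := LinearMap.surjective hτ
  have hp := (Fact.out : p.Prime).two_le
  obtain ⟨A, M, hA, hM, hAM⟩ := exists_card_sq_ge_val_dotProduct_le hτ k
  -- For `b` in `Z`, `τ (b + x ⬝ᵥ m)` has residue below `(p / 2 - p / 4) + p / 4 = p / 2`, while `τ
  -- y` has residue at least `p / 2` on `Y`.
  let Y : Finset F := Finset.univ.filter fun y =>
    τ y ∈ Finset.univ.filter fun x : ZMod p => x.val ∈ Finset.Ico (p / 2) p
  let Z : Finset F := Finset.univ.filter fun y =>
    τ y ∈ Finset.univ.filter fun x : ZMod p => x.val ∈ Finset.Ico 0 (p / 2 - p / 4)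
  have hY : Fintype.card F ≤ 8 * Y.card := by
    have h1 := AddMonoidHom.card_filter_mem_mul_card τ.toAddMonoidHom hsurj
      (Finset.univ.filter fun x : ZMod p => x.val ∈ Finset.Ico (p / 2) p)
    rw [ZMod.card_filter_val_mem_Ico _ _ le_rfl, ZMod.card] at h1
    change Y.card * p = _ at h1
    have h2 : p ≤ 8 * (p - p / 2) := by omega
    refine Nat.le_of_mul_le_mul_right (c := p) ?_ (by omega)
    calc Fintype.card F * p ≤ Fintype.card F * (8 * (p - p / 2)) := Nat.mul_le_mul_left _ h2
      _ = 8 * ((p - p / 2) * Fintype.card F) := by ring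
      _ = 8 * Y.card * p := by rw [← h1]; ring
  have hZ : Fintype.card F ≤ 8 * Z.card := by
    have h1 := AddMonoidHom.card_filter_mem_mul_card τ.toAddMonoidHom hsurj
      (Finset.univ.filter fun x : ZMod p => x.val ∈ Finset.Ico 0 (p / 2 - p / 4))
    rw [ZMod.card_filter_val_mem_Ico _ _ (by omega), ZMod.card] at h1
    change Z.card * p = _ at h1
    have h2 : p ≤ 8 * (p / 2 - p / 4 - 0) := by omega
    refine Nat.le_of_mul_le_mul_right (c := p) ?_ (by omega)
    calc Fintype.card F * p ≤ Fintype.card F * (8 * (p / 2 - p / 4 - 0)) :=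
          Nat.mul_le_mul_left _ h2
      _ = 8 * ((p / 2 - p / 4 - 0) * Fintype.card F) := by ring
      _ = 8 * Z.card * p := by rw [← h1]; ring
  have hcard {a b : ℕ} (ha : Fintype.card F ^ k ≤ 4 * a ^ 2) (hb : Fintype.card F ≤ 8 * b) :
      Fintype.card F ^ (k + 2) ≤ 256 * (a * b) ^ 2 := by
    calc Fintype.card F ^ (k + 2) = Fintype.card F ^ k * Fintype.card F ^ 2 := pow_add _ _ _
      _ ≤ 4 * a ^ 2 * (8 * b) ^ 2 := Nat.mul_le_mul ha (Nat.pow_le_pow_left hb 2)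
      _ = _ := by ring
  -- Coordinates `(y, 1, x)` and `(-1, b, m)` are orthogonal exactly when `y = b + x ⬝ᵥ m`.
  let f : (Fin k → F) × F → ℙ F (Fin (k + 2) → F) := fun x =>
    mk F (Matrix.vecCons x.2 (Matrix.vecCons 1 x.1)) fun h => one_ne_zero (congrFun h 1)
  let g : (Fin k → F) × F → ℙ F (Fin (k + 2) → F) := fun x =>
    mk F (Matrix.vecCons (-1) (Matrix.vecCons x.2 x.1)) fun h =>
      neg_ne_zero.2 one_ne_zero (congrFun h 0)
  have hf : Function.Injective f := by
    rintro ⟨x, y⟩ ⟨x', y'⟩ h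
    obtain ⟨a, ha⟩ := (mk_eq_mk_iff' _ _ _ _ _).1 h
    simp only [Matrix.smul_cons, smul_eq_mul, mul_one, Matrix.vecCons_inj] at ha
    obtain ⟨h1, rfl, h2⟩ := ha
    simp_all
  have hg : Function.Injective g := by
    rintro ⟨x, y⟩ ⟨x', y'⟩ h
    obtain ⟨a, ha⟩ := (mk_eq_mk_iff' _ _ _ _ _).1 h
    simp only [Matrix.smul_cons, smul_eq_mul, mul_neg, mul_one, neg_inj, Matrix.vecCons_inj] at ha
    obtain ⟨rfl, h1, h2⟩ := ha
    simp_all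
  refine ⟨(A ×ˢ Y).map ⟨f, hf⟩, (M ×ˢ Z).map ⟨g, hg⟩, ?_, ?_, ?_⟩
  · intro P hP H hH hPH
    obtain ⟨⟨x, y⟩, hxy, rfl⟩ := Finset.mem_map.1 hP
    obtain ⟨⟨m, b⟩, hmb, rfl⟩ := Finset.mem_map.1 hH
    obtain ⟨hx, hy⟩ := Finset.mem_product.1 hxy
    obtain ⟨hm, hb⟩ := Finset.mem_product.1 hmb
    have h1 : y = b + x ⬝ᵥ m := by
      have h0 := (orthogonal_mk _ _).1 hPH
      simp only [Matrix.cons_dotProduct_cons] at h0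
      linear_combination -h0
    simp only [Y, Z, Finset.mem_filter, Finset.mem_univ, true_and, Finset.mem_Ico] at hy hb
    have h2 := ZMod.val_add_le (τ b) (τ (x ⬝ᵥ m))
    rw [← map_add, ← h1] at h2
    have h3 := hAM x hx m hm
    omega
  · rw [Finset.card_map, Finset.card_product]
    exact hcard hA hY
  · rw [Finset.card_map, Finset.card_product]
    exact hcard hM hZ

/-! ### Assembly of the two bounds -/

/-- Upper and lower bounds on `θ_n - γ_e` in terms of squares. -/
theorem edgeDominationNumber_pointHyperplaneDesign {n : ℕ} (hn : 2 ≤ n) (F : Type*) [Field F]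
    [Finite F] {q v : ℕ} (hq : Nat.card F = q) (hv : v = ∑ i ∈ Finset.range (n + 1), q ^ i) :
    (∃ m : ℕ, q ^ (n + 1) ≤ 256 * m ^ 2 ∧
      2 * (pointHyperplaneDesign n F).edgeDominationNumber + m ≤ 2 * v) ∧
    ∃ m : ℕ, v ≤ m + (pointHyperplaneDesign n F).edgeDominationNumber ∧
      m ^ 2 ≤ 4 * q ^ (n + 1) := by
  classical
  obtain ⟨k, rfl⟩ : ∃ k, n = k + 2 := ⟨n - 2, by omega⟩
  have hn1 : 1 ≤ k + 2 := by omega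
  have hq2 : 2 ≤ q := hq ▸ Finite.one_lt_card
  have : Fintype F := Fintype.ofFinite F
  have : Fintype (ℙ F (Fin (k + 2 + 1) → F)) := Fintype.ofFinite _
  have : Fintype (pointHyperplaneDesign (k + 2) F).blocks := Fintype.ofEquiv _ (equivBlocks hn1)
  -- The design parameters: two points lie on `l` common hyperplanes, one point on `l + μ`.
  let l := ∑ i ∈ Finset.range (k + 1), q ^ i
  let μ := q ^ (k + 1)
  have hlμ : ∑ i ∈ Finset.range (k + 2), q ^ i = l + μ := Finset.sum_range_succ _ _
  have hlq : l + μ = q * l + 1 := by rw [← hlμ, geom_sum_succ]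
  have hvq : v = q * (l + μ) + 1 := by rw [hv, geom_sum_succ, hlμ]
  have hl1 : 1 ≤ l := by
    have : l = q * _ + 1 := geom_sum_succ
    omega
  have hμ2 : 2 ≤ μ := hq2.trans (Nat.le_self_pow (by omega) q)
  have hpar : (l + μ) ^ 2 = μ + l * v := by
    rw [hvq]
    zify at hlq ⊢
    linear_combination ((l : ℤ) + μ) * hlq
  have hμ : 4 * μ < (l + μ) ^ 2 := by nlinarith
  have hP : Fintype.card (ℙ F (Fin (k + 2 + 1) → F)) = v := by
    rw [← Nat.card_eq_fintype_card, Projectivization.card_of_finrank F _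
      (Module.finrank_fin_fun F), hq, hv]
  have hH : Fintype.card (pointHyperplaneDesign (k + 2) F).blocks = v := by
    rw [← hP]
    exact Fintype.card_congr (equivBlocks hn1).symm
  have hk (p : ℙ F (Fin (k + 2 + 1) → F)) :
      Nat.card {B : (pointHyperplaneDesign (k + 2) F).blocks // p ∈ (B : Set _)} = l + μ := by
    rw [card_blocks_mem hn1, hq, hlμ]
  have hl (p p' : ℙ F (Fin (k + 2 + 1) → F)) (hp : p ≠ p') :
      Nat.card {B : (pointHyperplaneDesign (k + 2) F).blocks //
        p ∈ (B : Set _) ∧ p' ∈ (B : Set _)} = l := by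
    rw [card_blocks_mem_and_mem hn1 hp, hq]
    rfl
  have hI' (B : (pointHyperplaneDesign (k + 2) F).blocks) :
      ∃ p : ℙ F (Fin (k + 2 + 1) → F), p ∈ (B : Set _) := by
    obtain ⟨h, rfl⟩ := (equivBlocks hn1).surjective B
    have h1 := Projectivization.card_orthogonal h
    have : Nonempty {p // Projectivization.orthogonal h p} := by
      refine (Nat.card_pos_iff.1 ?_).1
      rw [h1, hq, hlμ]
      omega
    obtain ⟨p, hp⟩ := this
    exact ⟨p, Projectivization.orthogonal_comm.1 hp⟩
  constructor
  · obtain ⟨S, T, hST, hS, hT⟩ := exists_incidenceFree_orthogonal F (k + 1)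
    rw [← Nat.card_eq_fintype_card, hq] at hS hT
    let m := min S.card T.card
    have hm : q ^ (k + 2 + 1) ≤ 256 * m ^ 2 := by
      rcases min_choice S.card T.card with h | h
      · simpa [m, h] using hS
      · simpa [m, h] using hT
    have hm0 : 0 < m := by
      by_contra hc
      have h0 : m = 0 := by omega
      have : 0 < q ^ (k + 2 + 1) := pow_pos (by omega) _
      rw [h0] at hm
      omega
    obtain ⟨X, hXS, hX⟩ := Finset.exists_subset_card_eq (min_le_left S.card T.card)
    obtain ⟨Y, hYT, hY⟩ := Finset.exists_subset_card_eq (min_le_right S.card T.card)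
    obtain ⟨Γ, h1, h2, h3, h4⟩ := IncidenceFree.exists_cover
      (I := fun p (B : (pointHyperplaneDesign (k + 2) F).blocks) => p ∈ (B : Set _))
      hP hH hk hl hpar hμ hI' (m := m) (X := X) (Y := Y.map (equivBlocks hn1).toEmbedding)
      hX ((Finset.card_map _).trans hY) hm0
    have h5 := IncidenceStructure.edgeDominationNumber_le_card (pointHyperplaneDesign (k + 2) F)
      (X := X) (Y := Y.map (equivBlocks hn1).toEmbedding) (by
        intro p hp B hB
        obtain ⟨h, hh, rfl⟩ := Finset.mem_map.1 hB
        exact hST p (hXS hp) h (hYT hh)) h1 h2 h3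
    exact ⟨m, hm, by omega⟩
  · obtain ⟨X, Y, hXY, hX, hY⟩ :=
      (pointHyperplaneDesign (k + 2) F).exists_incidenceFree_of_edgeDominationNumber
    rw [hP] at hX
    rw [hH] at hY
    refine ⟨min X.card Y.card, by omega, ?_⟩
    have h1 := hXY.card_mul_card_le hH hk hl hpar (by omega)
    have hX' : X.card ≤ v := hP ▸ Finset.card_le_univ X
    have hY' : Y.card ≤ v := hH ▸ Finset.card_le_univ Y
    have hX'' : (X.card : ℝ) ≤ v := by exact_mod_cast hX'
    have h2 : ((v : ℝ) - X.card) * (v - Y.card) ≤ v * v :=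
      mul_le_mul (by simp) (by simp) (by rw [sub_nonneg]; exact_mod_cast hY') (by simp)
    have h3 : ((l : ℝ) + μ) ^ 2 * (X.card * Y.card) ≤ μ * (v * v) :=
      h1.trans (mul_le_mul_of_nonneg_left h2 (Nat.cast_nonneg _))
    have h4 : (l + μ) ^ 2 * (X.card * Y.card) ≤ μ * (v * v) := by exact_mod_cast h3
    have h5 : v ≤ 2 * q * (l + μ) := by nlinarith
    have h6 : (l + μ) ^ 2 * (X.card * Y.card) ≤ (l + μ) ^ 2 * (4 * q ^ (k + 2 + 1)) := by
      refine h4.trans ((Nat.mul_le_mul_left μ (Nat.mul_le_mul h5 h5)).trans_eq ?_)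
      simp only [μ]
      ring
    refine le_trans ?_ (Nat.le_of_mul_le_mul_left h6 (by positivity))
    rw [sq]
    exact Nat.mul_le_mul (min_le_left _ _) (min_le_right _ _)

theorem mainTheorem7 :
    ∃ c C : ℝ, 0 < c ∧ 0 < C ∧
      ∀ (n : ℕ), 2 ≤ n → ∀ (F : Type*) [Field F] [Finite F] (q : ℕ), Nat.card F = q →
        c * (q : ℝ) ^ (((n : ℝ) + 1) / 2) ≤
            projTheta n q - ((pointHyperplaneDesign n F).edgeDominationNumber : ℝ) ∧
          projTheta n q - ((pointHyperplaneDesign n F).edgeDominationNumber : ℝ) ≤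
            C * (q : ℝ) ^ (((n : ℝ) + 1) / 2) := by
  -- The saving is at least `m / 2` with `16 * m ≥ x`, and at most `m' ≤ 2 * x`, where `x = q ^ ((n
  -- + 1) / 2)`.
  refine ⟨1 / 32, 2, by norm_num, by norm_num, fun n hn F _ _ q hq => ?_⟩
  have hq2 : 1 < q := hq ▸ Finite.one_lt_card
  obtain ⟨⟨m, hm, hγ⟩, m', hγ', hm'⟩ := edgeDominationNumber_pointHyperplaneDesign hn F hq rfl
  have hθ : projTheta n q = ((∑ i ∈ Finset.range (n + 1), q ^ i : ℕ) : ℝ) := by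
    rw [projTheta, Nat.cast_sum]
    simp only [Nat.cast_pow]
    exact (geom_sum_eq (by exact_mod_cast hq2.ne') (n + 1)).symm
  set γ := (pointHyperplaneDesign n F).edgeDominationNumber
  set v := ∑ i ∈ Finset.range (n + 1), q ^ i
  set x : ℝ := (q : ℝ) ^ (((n : ℝ) + 1) / 2)
  have hx0 : 0 ≤ x := Real.rpow_nonneg (Nat.cast_nonneg _) _
  have hx : x ^ 2 = (q : ℝ) ^ (n + 1) := by
    rw [← Real.rpow_natCast x 2, ← Real.rpow_mul (Nat.cast_nonneg _), ← Real.rpow_natCast]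
    push_cast
    ring_nf
  have h1 : x ^ 2 ≤ (16 * (m : ℝ)) ^ 2 := by
    rw [hx]
    have : (q : ℝ) ^ (n + 1) ≤ 256 * (m : ℝ) ^ 2 := by exact_mod_cast hm
    linarith
  have h2 : (m' : ℝ) ^ 2 ≤ (2 * x) ^ 2 := by
    rw [mul_pow, hx]
    have : (m' : ℝ) ^ 2 ≤ 4 * (q : ℝ) ^ (n + 1) := by exact_mod_cast hm'
    linarith
  have h3 := le_of_sq_le_sq h1 (by positivity)
  have h4 := le_of_sq_le_sq h2 (by positivity)
  have h5 : 2 * (γ : ℝ) + m ≤ 2 * v := by exact_mod_cast hγ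
  have h6 : (v : ℝ) ≤ m' + γ := by exact_mod_cast hγ'
  rw [hθ]
  constructor <;> linarith
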